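/- Let $\Lambda$ be the set of (possibly open) untyped $\lambda$-terms $t,u,s ::= v \mid tu$, with values $v ::= x \mid \lambda x.t$, identified up to $\alpha$-equivalence. Consider the root rules $$(\lambda x.t)v \mapsto_{\beta_v} t\{x{\leftarrow}v\},\qquad ((\lambda x.t)u)s \mapsto_{\sigma_1} (\lambda x.ts)u \ \ (x\notin \mathrm{fv}(s)),\qquad v((\lambda x.s)u)\mapsto_{\sigma_3}(\lambda x.vs)u \ \ (x\notin\mathrm{fv}(v)),$$ where $v$ is a value, and let $\to_{\beta_v}$, $\to_{\sigma_1}$, $\to_{\sigma_3}$ be their closures under balanced contexts $B ::= \langle\cdot\rangle \mid tB \mid Bt \mid (\lambda x.B)t$. Put $\to_\sigma\, =\, \to_{\sigma_1}\cup\to_{\sigma_3}$ and $\to_{\mathsf{shuf}}\, =\, \to_{\beta_v}\cup\to_\sigma$ (the shuffling calculus). A $\mathsf{shuf}$-derivation from $t$ is a finite sequence of consecutive $\to_{\mathsf{shuf}}$-steps starting at $t$, each step being recorded as a $\to_{\beta_v}$-step or as a $\to_\sigma$-step; it is normalizing if its last term is $\mathsf{shuf}$-normal, that is, has no $\to_{\mathsf{shuf}}$-step.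 (1) For every $t\in\Lambda$, all normalizing $\mathsf{shuf}$-derivations from $t$ (if any) have the same number of $\beta_v$-steps. Consequently, the difference between the lengths of two such derivations equals the difference between their numbers of $\to_\sigma$-steps. (2) The relation $\to_{\mathsf{shuf}}$ is not strongly confluent, i.e. it is not the case that whenever $t\to_{\mathsf{shuf}}u$, $t\to_{\mathsf{shuf}}s$ and $u\neq s$ there is $r$ with $u\to_{\mathsf{shuf}}r$ and $s\to_{\mathsf{shuf}}r$. Moreover, there is a term with two normalizing $\mathsf{shuf}$-derivations of different lengths. -/

import Mathlib

namespace Shuffling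

/-- The set `Λ` of (possibly open) λ-terms, identified up to α-equivalence. Bound variables are
de Bruijn indices; under `k` binders the index `n + k` denotes the free variable number `n`. -/
inductive Term : Type
  | var (n : ℕ) : Term
  | app (t u : Term) : Term
  | lam (t : Term) : Term

namespace Term

/-- Extension of a renaming of variables under one binder. -/
def upRen (ξ : ℕ → ℕ) : ℕ → ℕ
  | 0 => 0
  | n + 1 => ξ n + 1

/-- Capture-avoiding renaming of the free variables of a term. -/
def rename : (ℕ → ℕ) → Term → Term
  | ξ, var n => var (ξ n)
  | ξ, app t u => app (rename ξ t) (rename ξ u)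
  | ξ, lam t => lam (rename (upRen ξ) t)

/-- The term `t` read under one more binder, whose variable does not occur free in it. -/
def shift (t : Term) : Term := rename Nat.succ t

/-- Extension of a substitution under one binder. -/
def upSubst (σ : ℕ → Term) : ℕ → Term
  | 0 => var 0
  | n + 1 => shift (σ n)

/-- Capture-avoiding simultaneous substitution. -/
def subst : (ℕ → Term) → Term → Term
  | σ, var n => σ n
  | σ, app t u => app (subst σ t) (subst σ u)
  | σ, lam t => lam (subst (upSubst σ) t)

/-- The substitution of `u` for the variable of index `0`, the outermost binder being removed. -/
def single (u : Term) : ℕ → Term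
  | 0 => u
  | n + 1 => var n

/-- `t{x←u}`, where `t` is the body of an abstraction `λx.t`. -/
def inst (t u : Term) : Term := subst (single u) t

/-- Values: variables and abstractions. -/
inductive IsValue : Term → Prop
  | var (n : ℕ) : IsValue (var n)
  | lam (t : Term) : IsValue (lam t)

end Term

open Term

/-- Balanced contexts `B ::= ⟨·⟩ | t B | B t | (λx.B) t`. -/
inductive BalancedCtx : Type
  | hole : BalancedCtx
  | appRight (t : Term) (B : BalancedCtx) : BalancedCtx
  | appLeft (B : BalancedCtx) (t : Term) : BalancedCtx
  | lamApp (B : BalancedCtx) (t : Term) : BalancedCtx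

/-- Plugging `B⟨t⟩`; the binders of `B` above the hole may capture free variables of `t`. -/
def BalancedCtx.plug : BalancedCtx → Term → Term
  | hole, s => s
  | appRight t B, s => app t (B.plug s)
  | appLeft B t, s => app (B.plug s) t
  | lamApp B t, s => app (lam (B.plug s)) t

/-- Closure of a root rule under balanced contexts. -/
inductive BalancedClosure (R : Term → Term → Prop) : Term → Term → Prop
  | plug (B : BalancedCtx) {t u : Term} (h : R t u) : BalancedClosure R (B.plug t) (B.plug u)

/-- Root rule `(λx.t) v ↦ t{x←v}`, with `v` a value. -/
inductive RootBetaV : Term → Term → Prop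
  | mk (t v : Term) (hv : IsValue v) : RootBetaV (app (lam t) v) (t.inst v)

/-- Root rule `((λx.t) u) s ↦ (λx.t s) u`, with `x` not free in `s`. -/
inductive RootSigmaL : Term → Term → Prop
  | mk (t u s : Term) : RootSigmaL (app (app (lam t) u) s) (app (lam (app t s.shift)) u)

/-- Root rule `v ((λx.s) u) ↦ (λx.v s) u`, with `v` a value and `x` not free in `v`. -/
inductive RootSigmaR : Term → Term → Prop
  | mk (v s u : Term) (hv : IsValue v) :
      RootSigmaR (app v (app (lam s) u)) (app (lam (app v.shift s)) u)

/-- The reduction `→_βv` of the shuffling calculus. -/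
def StepBetaV : Term → Term → Prop := BalancedClosure RootBetaV

/-- The left shuffling reduction. -/
def StepSigmaL : Term → Term → Prop := BalancedClosure RootSigmaL

/-- The right shuffling reduction. -/
def StepSigmaR : Term → Term → Prop := BalancedClosure RootSigmaR

/-- The shuffling reduction `→_σ`, the union of the left and the right one. -/
def StepSigma (t u : Term) : Prop := StepSigmaL t u ∨ StepSigmaR t u

/-- The reduction `→_shuf` of the shuffling calculus, the union of `→_βv` and `→_σ`. -/
def StepShuf (t u : Term) : Prop := StepBetaV t u ∨ StepSigma t u

/-- `t` is normal for `R`: it has no `R`-step. -/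
def IsNormal {α : Type*} (R : α → α → Prop) (t : α) : Prop := ∀ u, ¬ R t u

/-- Strong confluence: two distinct one-step reducts of a term are joined by one step each. -/
def StronglyConfluent {α : Type*} (R : α → α → Prop) : Prop :=
  ∀ t u s, R t u → R t s → u ≠ s → ∃ r, R u r ∧ R s r

/-- `shuf`-derivations from `t` to `u`: finite sequences of consecutive `→_shuf`-steps, each of
them recorded as a `→_βv`-step or as a `→_σ`-step. -/
inductive Derivation : Term → Term → Type
  | nil (t : Term) : Derivation t t
  | betaV {t u s : Term} (h : StepBetaV t u) (d : Derivation u s) : Derivation t s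
  | sigma {t u s : Term} (h : StepSigma t u) (d : Derivation u s) : Derivation t s

namespace Derivation

/-- The length of a derivation. -/
def length : {t u : Term} → Derivation t u → ℕ
  | _, _, nil _ => 0
  | _, _, betaV _ d => d.length + 1
  | _, _, sigma _ d => d.length + 1

/-- The number of `→_βv`-steps of a derivation. -/
def numBetaV : {t u : Term} → Derivation t u → ℕ
  | _, _, nil _ => 0
  | _, _, betaV _ d => d.numBetaV + 1
  | _, _, sigma _ d => d.numBetaV

/-- The number of shuffling steps of a derivation. -/
def numSigma : {t u : Term} → Derivation t u → ℕ
  | _, _, nil _ => 0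
  | _, _, betaV _ d => d.numSigma
  | _, _, sigma _ d => d.numSigma + 1

/-- A derivation is normalizing if its last term is `shuf`-normal. -/
def IsNormalizing {t u : Term} (_d : Derivation t u) : Prop := IsNormal StepShuf u

end Derivation

end Shuffling

namespace Shuffling

open Term Relation

namespace Term

/-! ### Renaming and substitution -/

/-! Reduction never enters an unapplied abstraction and only values are substituted, so no step
duplicates or erases a redex of `→_βv`. Hence `→_βv` has the diamond property (`Bv.diamond`), and a
`→_βv`-step crosses any `→_σ`-step as exactly one `→_βv`-step (`Bv.sigma_commute`). Alone, `→_σ`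
terminates and is locally confluent, hence confluent. A normalizing derivation can therefore be
transported along `→_σ`-steps with its `βv`-count unchanged, and along a `→_βv`-step with its count
lowered by one; following one derivation while transporting the other equates the counts.

Strong confluence would in the same way fix the total length. It fails on the critical pair of
`forkTerm`, whose two sides reach the same normal form in 2 and 3 steps. -/

theorem rename_eq_subst (ξ : ℕ → ℕ) (t : Term) : rename ξ t = subst (fun n => var (ξ n)) t := by
  induction t generalizing ξ with
  | var n => rfl
  | app t u iht ihu => simp only [rename, subst, iht, ihu]
  | lam t ih =>
    simp only [rename, subst, ih]
    congr 2
    funext n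
    cases n <;> rfl

theorem subst_rename (σ : ℕ → Term) (ξ : ℕ → ℕ) (t : Term) :
    subst σ (rename ξ t) = subst (fun n => σ (ξ n)) t := by
  induction t generalizing σ ξ with
  | var n => rfl
  | app t u iht ihu => simp only [rename, subst, iht, ihu]
  | lam t ih =>
    simp only [rename, subst, ih]
    congr 2
    funext n
    cases n <;> rfl

theorem rename_rename (ξ ζ : ℕ → ℕ) (t : Term) :
    rename ξ (rename ζ t) = rename (fun n => ξ (ζ n)) t := by
  rw [rename_eq_subst ξ, subst_rename, rename_eq_subst]

theorem rename_subst (ξ : ℕ → ℕ) (σ : ℕ → Term) (t : Term) :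
    rename ξ (subst σ t) = subst (fun n => rename ξ (σ n)) t := by
  induction t generalizing σ ξ with
  | var n => rfl
  | app t u iht ihu => simp only [rename, subst, iht, ihu]
  | lam t ih =>
    simp only [rename, subst, ih]
    congr 2
    funext n
    cases n with
    | zero => rfl
    | succ n => simp only [upSubst, shift, rename_rename, upRen]

theorem subst_upSubst_shift (σ : ℕ → Term) (t : Term) :
    subst (upSubst σ) (shift t) = shift (subst σ t) := by
  simp only [shift, subst_rename, rename_subst, upSubst]

theorem subst_subst (τ σ : ℕ → Term) (t : Term) :
    subst τ (subst σ t) = subst (fun n => subst τ (σ n)) t := by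
  induction t generalizing τ σ with
  | var n => rfl
  | app t u iht ihu => simp only [subst, iht, ihu]
  | lam t ih =>
    simp only [subst, ih]
    congr 2
    funext n
    cases n with
    | zero => rfl
    | succ n => exact subst_upSubst_shift τ (σ n)

theorem subst_var (t : Term) : subst var t = t := by
  induction t with
  | var n => rfl
  | app t u iht ihu => simp only [subst, iht, ihu]
  | lam t ih =>
    have h : upSubst var = var := by
      funext n
      cases n <;> rfl
    simp only [subst, h, ih]

theorem inst_shift (t u : Term) : inst (shift t) u = t := by
  simp only [inst, shift, subst_rename]
  exact subst_var t

theorem subst_inst (τ : ℕ → Term) (t u : Term) :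
    subst τ (inst t u) = inst (subst (upSubst τ) t) (subst τ u) := by
  simp only [inst, subst_subst]
  congr 1
  funext n
  cases n with
  | zero => rfl
  | succ n => exact (inst_shift (τ n) (subst τ u)).symm

theorem IsValue.subst {v : Term} (hv : IsValue v) {σ : ℕ → Term} (hσ : ∀ n, IsValue (σ n)) :
    IsValue (subst σ v) := by
  cases hv with
  | var n => exact hσ n
  | lam t => exact .lam _

theorem IsValue.shift {v : Term} (hv : IsValue v) : IsValue v.shift := by
  cases hv with
  | var n => exact .var _
  | lam t => exact .lam _

theorem isValue_single {v : Term} (hv : IsValue v) (n : ℕ) : IsValue (single v n) := by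
  cases n with
  | zero => exact hv
  | succ n => exact .var n

theorem isValue_upSubst {σ : ℕ → Term} (hσ : ∀ n, IsValue (σ n)) (n : ℕ) :
    IsValue (upSubst σ n) := by
  cases n with
  | zero => exact .var 0
  | succ n => exact (hσ n).shift

end Term

/-! ### Inductive presentations of the two reductions -/

/-- The reduction `→_βv`, presented by its congruence rules. -/
inductive Bv : Term → Term → Prop
  | root (t : Term) {v : Term} (hv : IsValue v) : Bv (app (lam t) v) (t.inst v)
  | appRight (t : Term) {u u' : Term} (h : Bv u u') : Bv (app t u) (app t u')
  | appLeft {t t' : Term} (h : Bv t t') (u : Term) : Bv (app t u) (app t' u)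
  | lamApp {t t' : Term} (h : Bv t t') (u : Term) : Bv (app (lam t) u) (app (lam t') u)

/-- The reduction `→_σ`, presented by its congruence rules. -/
inductive Sg : Term → Term → Prop
  | left (t u s : Term) : Sg (app (app (lam t) u) s) (app (lam (app t s.shift)) u)
  | right {v : Term} (hv : IsValue v) (s u : Term) :
      Sg (app v (app (lam s) u)) (app (lam (app v.shift s)) u)
  | appRight (t : Term) {u u' : Term} (h : Sg u u') : Sg (app t u) (app t u')
  | appLeft {t t' : Term} (h : Sg t t') (u : Term) : Sg (app t u) (app t' u)
  | lamApp {t t' : Term} (h : Sg t t') (u : Term) : Sg (app (lam t) u) (app (lam t') u)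

/-- Congruence rules replace contexts so that two steps from one term can be compared by case
analysis. -/
theorem stepBetaV_iff {t u : Term} : StepBetaV t u ↔ Bv t u := by
  constructor
  · rintro ⟨B, ⟨t, v, hv⟩⟩
    induction B with
    | hole => exact .root t hv
    | appRight s B ih => exact .appRight s ih
    | appLeft B s ih => exact .appLeft ih s
    | lamApp B s ih => exact .lamApp ih s
  · intro h
    induction h with
    | root t hv => exact .plug .hole (.mk t _ hv)
    | appRight t _ ih =>
      obtain ⟨B, h⟩ := ih
      exact .plug (.appRight t B) h
    | appLeft _ u ih =>
      obtain ⟨B, h⟩ := ih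
      exact .plug (.appLeft B u) h
    | lamApp _ u ih =>
      obtain ⟨B, h⟩ := ih
      exact .plug (.lamApp B u) h

theorem stepSigma_iff {t u : Term} : StepSigma t u ↔ Sg t u := by
  constructor
  · rintro (⟨B, ⟨t, u, s⟩⟩ | ⟨B, ⟨v, s, u, hv⟩⟩)
    · induction B with
      | hole => exact .left t u s
      | appRight s B ih => exact .appRight s ih
      | appLeft B s ih => exact .appLeft ih s
      | lamApp B s ih => exact .lamApp ih s
    · induction B with
      | hole => exact .right hv s u
      | appRight s B ih => exact .appRight s ih
      | appLeft B s ih => exact .appLeft ih s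
      | lamApp B s ih => exact .lamApp ih s
  · intro h
    induction h with
    | left t u s => exact .inl (.plug .hole (.mk t u s))
    | right hv s u => exact .inr (.plug .hole (.mk _ s u hv))
    | appRight t _ ih =>
      obtain ⟨B, h⟩ | ⟨B, h⟩ := ih
      · exact .inl (.plug (.appRight t B) h)
      · exact .inr (.plug (.appRight t B) h)
    | appLeft _ u ih =>
      obtain ⟨B, h⟩ | ⟨B, h⟩ := ih
      · exact .inl (.plug (.appLeft B u) h)
      · exact .inr (.plug (.appLeft B u) h)
    | lamApp _ u ih =>
      obtain ⟨B, h⟩ | ⟨B, h⟩ := ih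
      · exact .inl (.plug (.lamApp B u) h)
      · exact .inr (.plug (.lamApp B u) h)

theorem Bv.not_isValue {t u : Term} (h : Bv t u) : ¬ IsValue t := by
  intro hv
  cases hv <;> cases h

theorem Sg.not_isValue {t u : Term} (h : Sg t u) : ¬ IsValue t := by
  intro hv
  cases hv <;> cases h

/-- Substituted terms must be values, or the argument of a redex could cease to be one. This carries
a step in the body of a redex across its contraction. -/
theorem Bv.subst {t u : Term} (h : Bv t u) {σ : ℕ → Term} (hσ : ∀ n, IsValue (σ n)) :
    Bv (subst σ t) (subst σ u) := by
  induction h generalizing σ with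
  | root t hv =>
    rw [subst_inst]
    exact .root _ (hv.subst hσ)
  | appRight t _ ih => exact .appRight _ (ih hσ)
  | appLeft _ u ih => exact .appLeft (ih hσ) _
  | lamApp _ u ih => exact .lamApp (ih (isValue_upSubst hσ)) _

theorem Sg.subst {t u : Term} (h : Sg t u) {σ : ℕ → Term} (hσ : ∀ n, IsValue (σ n)) :
    Sg (subst σ t) (subst σ u) := by
  induction h generalizing σ with
  | left t u s =>
    simp only [Term.subst, subst_upSubst_shift]
    exact .left _ _ _
  | right hv s u =>
    simp only [Term.subst, subst_upSubst_shift]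
    exact .right (hv.subst hσ) _ _
  | appRight t _ ih => exact .appRight _ (ih hσ)
  | appLeft _ u ih => exact .appLeft (ih hσ) _
  | lamApp _ u ih => exact .lamApp (ih (isValue_upSubst hσ)) _

theorem Bv.rename {t u : Term} (h : Bv t u) (ξ : ℕ → ℕ) :
    Bv (rename ξ t) (rename ξ u) := by
  simp only [rename_eq_subst]
  exact h.subst fun n => .var _

theorem Sg.rename {t u : Term} (h : Sg t u) (ξ : ℕ → ℕ) :
    Sg (rename ξ t) (rename ξ u) := by
  simp only [rename_eq_subst]
  exact h.subst fun n => .var _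

/-! ### Local diagrams -/

theorem Bv.diamond {t u s : Term} (hu : Bv t u) (hs : Bv t s) :
    u = s ∨ ∃ r, Bv u r ∧ Bv s r := by
  induction hu generalizing s with
  | root t hv =>
    cases hs with
    | root => exact .inl rfl
    | appRight _ h => exact (h.not_isValue hv).elim
    | appLeft h => cases h
    | lamApp h => exact .inr ⟨_, h.subst (isValue_single hv), .root _ hv⟩
  | appRight t hu ih =>
    cases hs with
    | root _ hv => exact (hu.not_isValue hv).elim
    | appRight _ h =>
      obtain rfl | ⟨r, h₁, h₂⟩ := ih h
      · exact .inl rfl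
      · exact .inr ⟨_, .appRight _ h₁, .appRight _ h₂⟩
    | appLeft h => exact .inr ⟨_, .appLeft h _, .appRight _ hu⟩
    | lamApp h => exact .inr ⟨_, .lamApp h _, .appRight _ hu⟩
  | appLeft hu u ih =>
    cases hs with
    | root => cases hu
    | appRight _ h => exact .inr ⟨_, .appRight _ h, .appLeft hu _⟩
    | appLeft h =>
      obtain rfl | ⟨r, h₁, h₂⟩ := ih h
      · exact .inl rfl
      · exact .inr ⟨_, .appLeft h₁ _, .appLeft h₂ _⟩
    | lamApp => cases hu
  | lamApp hu u ih =>
    cases hs with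
    | root _ hv => exact .inr ⟨_, .root _ hv, hu.subst (isValue_single hv)⟩
    | appRight _ h => exact .inr ⟨_, .appRight _ h, .lamApp hu _⟩
    | appLeft h => cases h
    | lamApp h =>
      obtain rfl | ⟨r, h₁, h₂⟩ := ih h
      · exact .inl rfl
      · exact .inr ⟨_, .lamApp h₁ _, .lamApp h₂ _⟩

theorem Bv.sigma_commute {t u s : Term} (hu : Bv t u) (hs : Sg t s) :
    ∃ r, ReflGen Sg u r ∧ Bv s r := by
  induction hu generalizing s with
  | root t hv =>
    cases hs with
    | right => cases hv
    | appRight _ h => exact (h.not_isValue hv).elim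
    | appLeft h => cases h
    | lamApp h => exact ⟨_, .single (h.subst (isValue_single hv)), .root _ hv⟩
  | appRight t hu ih =>
    cases hs with
    | left => exact ⟨_, .single (.left _ _ _), .lamApp (.appRight _ (hu.rename _)) _⟩
    | right hv s w =>
      cases hu with
      | root _ hw =>
        -- The contracted redex is the one being shuffled: contracting it afterwards leaves the
        -- shifted value intact, so nothing remains of the `→_σ`-step.
        refine ⟨_, .refl, ?_⟩
        have h := Bv.root (app t.shift s) hw
        rwa [show (app t.shift s).inst w = app (t.shift.inst w) (s.inst w) from rfl,
          inst_shift] at h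
      | appRight _ h => exact ⟨_, .single (.right hv _ _), .appRight _ h⟩
      | appLeft h => cases h
      | lamApp h => exact ⟨_, .single (.right hv _ _), .lamApp (.appRight _ h) _⟩
    | appRight _ h =>
      obtain ⟨r, h₁, h₂⟩ := ih h
      refine ⟨_, ?_, .appRight _ h₂⟩
      cases h₁ with
      | refl => exact .refl
      | single h₁ => exact .single (.appRight _ h₁)
    | appLeft h => exact ⟨_, .single (.appLeft h _), .appRight _ hu⟩
    | lamApp h => exact ⟨_, .single (.lamApp h _), .appRight _ hu⟩
  | appLeft hu u ih =>
    cases hs with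
    | left a b =>
      cases hu with
      | root _ hb =>
        refine ⟨_, .refl, ?_⟩
        have h := Bv.root (app a u.shift) hb
        rwa [show (app a u.shift).inst b = app (a.inst b) (u.shift.inst b) from rfl,
          inst_shift] at h
      | appRight _ h => exact ⟨_, .single (.left _ _ _), .appRight _ h⟩
      | appLeft h => cases h
      | lamApp h => exact ⟨_, .single (.left _ _ _), .lamApp (.appLeft h _) _⟩
    | right hv => exact (hu.not_isValue hv).elim
    | appRight _ h => exact ⟨_, .single (.appRight _ h), .appLeft hu _⟩
    | appLeft h =>
      obtain ⟨r, h₁, h₂⟩ := ih h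
      refine ⟨_, ?_, .appLeft h₂ _⟩
      cases h₁ with
      | refl => exact .refl
      | single h₁ => exact .single (.appLeft h₁ _)
    | lamApp => cases hu
  | lamApp hu u ih =>
    cases hs with
    | right hv s w =>
      exact ⟨_, .single (.right (.lam _) _ _), .lamApp (.lamApp (hu.rename _) _) _⟩
    | appRight _ h => exact ⟨_, .single (.appRight _ h), .lamApp hu _⟩
    | appLeft h => cases h
    | lamApp h =>
      obtain ⟨r, h₁, h₂⟩ := ih h
      refine ⟨_, ?_, .lamApp h₂ _⟩
      cases h₁ with
      | refl => exact .refl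
      | single h₁ => exact .single (.lamApp h₁ _)

/-- Critical pair of the left rule with a shuffling step inside its redex. -/
theorem Sg.left_inner_join {a b c t' : Term} (h : Sg (app (lam a) b) t') :
    Join (ReflTransGen Sg) (app (lam (app a c.shift)) b) (app t' c) := by
  cases h with
  | right _ p q =>
    -- One step against two: this pair is what breaks strong confluence.
    refine ⟨_, .single (.right (.lam _) p q), .trans (.single (.left _ _ _))
      (.single ?_)⟩
    have h := Sg.lamApp (Sg.left (Term.rename (upRen Nat.succ) a) p c.shift) q
    simp only [shift, Term.rename, rename_rename, upRen] at h ⊢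
    exact h
  | appRight _ h => exact ⟨_, .single (.appRight _ h), .single (.left _ _ _)⟩
  | appLeft h => cases h
  | lamApp h => exact ⟨_, .single (.lamApp (.appLeft h _) _), .single (.left _ _ _)⟩

/-- Critical pair of the right rule with a shuffling step inside the argument of its redex. -/
theorem Sg.right_inner_join {v a b t' : Term} (hv : IsValue v) (h : Sg (app (lam a) b) t') :
    Join (ReflTransGen Sg) (app (lam (app v.shift a)) b) (app v t') := by
  cases h with
  | right _ p q =>
    refine ⟨_, .single (.right (.lam _) p q), .trans (.single (.right hv _ _))
      (.single ?_)⟩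
    have h := Sg.lamApp (Sg.right hv.shift (Term.rename (upRen Nat.succ) a) p) q
    simp only [shift, Term.rename, rename_rename, upRen] at h ⊢
    exact h
  | appRight _ h => exact ⟨_, .single (.appRight _ h), .single (.right hv _ _)⟩
  | appLeft h => cases h
  | lamApp h => exact ⟨_, .single (.lamApp (.appRight _ h) _), .single (.right hv _ _)⟩

theorem Sg.locallyConfluent {t u s : Term} (hu : Sg t u) (hs : Sg t s) :
    Join (ReflTransGen Sg) u s := by
  have symm : ∀ {a b : Term}, Join (ReflTransGen Sg) a b → Join (ReflTransGen Sg) b a :=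
    fun ⟨r, h₁, h₂⟩ => ⟨r, h₂, h₁⟩
  induction hu generalizing s with
  | left a b c =>
    cases hs with
    | left => exact ⟨_, .refl, .refl⟩
    | right hv => cases hv
    | appRight _ h =>
      exact ⟨_, .single (.lamApp (.appRight _ (h.rename _)) _), .single (.left _ _ _)⟩
    | appLeft h => exact h.left_inner_join
  | right hv a b =>
    cases hs with
    | left => cases hv
    | right => exact ⟨_, .refl, .refl⟩
    | appRight _ h => exact Sg.right_inner_join hv h
    | appLeft h => exact (h.not_isValue hv).elim
    | lamApp h =>
      exact ⟨_, .single (.lamApp (.lamApp (h.rename _) _) _), .single (.right (.lam _) _ _)⟩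
  | appRight t hu ih =>
    cases hs with
    | left =>
      exact ⟨_, .single (.left _ _ _), .single (.lamApp (.appRight _ (hu.rename _)) _)⟩
    | right hv => exact symm (Sg.right_inner_join hv hu)
    | appRight _ h =>
      obtain ⟨r, h₁, h₂⟩ := ih h
      exact ⟨_, h₁.lift (app t) fun _ _ => .appRight t, h₂.lift (app t) fun _ _ => .appRight t⟩
    | appLeft h => exact ⟨_, .single (.appLeft h _), .single (.appRight _ hu)⟩
    | lamApp h => exact ⟨_, .single (.lamApp h _), .single (.appRight _ hu)⟩
  | appLeft hu u ih =>
    cases hs with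
    | left => exact symm hu.left_inner_join
    | right hv => exact (hu.not_isValue hv).elim
    | appRight _ h => exact ⟨_, .single (.appRight _ h), .single (.appLeft hu _)⟩
    | appLeft h =>
      obtain ⟨r, h₁, h₂⟩ := ih h
      exact ⟨_, h₁.lift (app · u) fun _ _ h => .appLeft h u,
        h₂.lift (app · u) fun _ _ h => .appLeft h u⟩
    | lamApp => cases hu
  | lamApp hu u ih =>
    cases hs with
    | right =>
      exact ⟨_, .single (.right (.lam _) _ _), .single (.lamApp (.lamApp (hu.rename _) _) _)⟩
    | appRight _ h => exact ⟨_, .single (.appRight _ h), .single (.lamApp hu _)⟩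
    | appLeft h => cases h
    | lamApp h =>
      obtain ⟨r, h₁, h₂⟩ := ih h
      exact ⟨_, h₁.lift (fun t => app (lam t) u) fun _ _ h => .lamApp h u,
        h₂.lift (fun t => app (lam t) u) fun _ _ h => .lamApp h u⟩

/-! ### Termination and confluence of the shuffling steps -/

/-- A measure that decreases along shuffling steps; applied abstractions weigh less than other
applications. -/
def shuffleWeight : Term → ℕ
  | var _ => 1
  | lam t => shuffleWeight t + 1
  | app (lam t) u => shuffleWeight t + 1 + 2 * shuffleWeight u
  | app t u => 2 * shuffleWeight t + 2 * shuffleWeight u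

theorem shuffleWeight_app_le (t u : Term) :
    shuffleWeight (app t u) ≤ 2 * shuffleWeight t + 2 * shuffleWeight u := by
  cases t <;> simp only [shuffleWeight] <;> omega

theorem shuffleWeight_app_app (t s u : Term) :
    shuffleWeight (app (app t s) u) = 2 * shuffleWeight (app t s) + 2 * shuffleWeight u := by
  simp only [shuffleWeight]

theorem shuffleWeight_pos (t : Term) : 0 < shuffleWeight t := by
  fun_induction shuffleWeight t <;> omega

theorem shuffleWeight_rename (ξ : ℕ → ℕ) (t : Term) :
    shuffleWeight (rename ξ t) = shuffleWeight t := by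
  fun_induction shuffleWeight t generalizing ξ with
  | case1 => simp only [rename, shuffleWeight]
  | case2 t ih => simp only [rename, shuffleWeight, ih]
  | case3 t u iht ihu => simp only [rename, shuffleWeight, iht, ihu]
  | case4 t u ht iht ihu =>
    cases t with
    | var n => simp only [rename, shuffleWeight, ihu]
    | app t s =>
      have h := iht ξ
      simp only [rename, shuffleWeight_app_app, ihu] at h ⊢
      rw [h]
    | lam t => exact (ht t rfl).elim

/-- A root step lifts the argument `u` out of one application, so its contribution drops from `4 *
shuffleWeight u` to `2 * shuffleWeight u`. -/
theorem Sg.shuffleWeight_lt {t u : Term} (h : Sg t u) : shuffleWeight u < shuffleWeight t := by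
  induction h with
  | left t u s =>
    have h := shuffleWeight_app_le t s.shift
    have hu := shuffleWeight_pos u
    simp only [shuffleWeight, shift, shuffleWeight_rename] at h ⊢
    omega
  | right hv s u =>
    have hu := shuffleWeight_pos u
    cases hv with
    | var n =>
      simp only [shift, Term.rename, shuffleWeight]
      omega
    | lam t =>
      have h := shuffleWeight_rename Nat.succ (lam t)
      simp only [shift, Term.rename, shuffleWeight] at h ⊢
      omega
  | appRight t _ ih => cases t <;> simp only [shuffleWeight] <;> omega
  | appLeft h u ih =>
    -- Both sides of a step are applications, so the clause for applied abstractions cannot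
    -- interfere.
    cases h <;> rw [shuffleWeight_app_app, shuffleWeight_app_app] <;> omega
  | lamApp _ u ih =>
    simp only [shuffleWeight]
    omega

/-- Newman's lemma, by induction on the weight. -/
theorem Sg.confluent {t u s : Term} (hu : ReflTransGen Sg t u) (hs : ReflTransGen Sg t s) :
    Join (ReflTransGen Sg) u s := by
  induction h : shuffleWeight t using Nat.strong_induction_on generalizing t u s with
  | _ n ih =>
    subst h
    obtain rfl | ⟨t₁, h₁, hu⟩ := hu.cases_head
    · exact ⟨s, hs, .refl⟩
    obtain rfl | ⟨t₂, h₂, hs⟩ := hs.cases_head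
    · exact ⟨u, .refl, .head h₁ hu⟩
    obtain ⟨r, hr₁, hr₂⟩ := h₁.locallyConfluent h₂
    obtain ⟨p, hp, hrp⟩ := ih _ h₁.shuffleWeight_lt hu hr₁ rfl
    obtain ⟨q, hq, hsq⟩ := ih _ h₂.shuffleWeight_lt (hr₂.trans hrp) hs rfl
    exact ⟨q, hp.trans hq, hsq⟩

theorem Bv.sigma_star_commute {t u s : Term} (hu : Bv t u) (hs : ReflTransGen Sg t s) :
    ∃ r, ReflTransGen Sg u r ∧ Bv s r := by
  induction hs with
  | refl => exact ⟨u, .refl, hu⟩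
  | tail _ h ih =>
    obtain ⟨r, hr, h'⟩ := ih
    obtain ⟨p, hp, h''⟩ := h'.sigma_commute h
    exact ⟨p, hr.trans hp.to_reflTransGen, h''⟩

/-! ### Normalizing derivations -/

theorem isNormal_stepShuf_iff {t : Term} :
    IsNormal StepShuf t ↔ (∀ u, ¬ Bv t u) ∧ ∀ u, ¬ Sg t u := by
  simp only [IsNormal, StepShuf, stepBetaV_iff, stepSigma_iff, not_or, forall_and]

namespace Derivation

theorem exists_of_sigma_star {t u s : Term} (h : ReflTransGen Sg t u) (d : Derivation u s) :
    ∃ d' : Derivation t s, d'.numBetaV = d.numBetaV := by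
  induction h using ReflTransGen.head_induction_on with
  | refl => exact ⟨d, rfl⟩
  | head h _ ih =>
    obtain ⟨d', hd'⟩ := ih
    exact ⟨.sigma (stepSigma_iff.2 h) d', hd'⟩

/-- A normalizing derivation can be transported along shuffling steps. -/
theorem exists_numBetaV_eq_of_sigma {t u s : Term} (d : Derivation t s) (hd : d.IsNormalizing)
    (h : ReflTransGen Sg t u) : ∃ d' : Derivation u s, d'.numBetaV = d.numBetaV := by
  induction d generalizing u with
  | nil t =>
    obtain rfl | ⟨_, h, _⟩ := h.cases_head
    · exact ⟨.nil _, rfl⟩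
    · exact ((isNormal_stepShuf_iff.1 hd).2 _ h).elim
  | betaV hb d ih =>
    obtain ⟨r, h₁, h₂⟩ := (stepBetaV_iff.1 hb).sigma_star_commute h
    obtain ⟨d', hd'⟩ := ih hd h₁
    exact ⟨.betaV (stepBetaV_iff.2 h₂) d', congrArg (· + 1) hd'⟩
  | sigma hs d ih =>
    -- Joins of any length are harmless here, since `→_σ`-steps are not counted.
    obtain ⟨r, h₁, h₂⟩ := Sg.confluent (.single (stepSigma_iff.1 hs)) h
    obtain ⟨d₁, hd₁⟩ := ih hd h₁
    obtain ⟨d₂, hd₂⟩ := exists_of_sigma_star h₂ d₁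
    exact ⟨d₂, hd₂.trans hd₁⟩

/-- Every `βv`-step is the first one of a derivation which is as good as a given normalizing
one. -/
theorem exists_numBetaV_succ_eq {t u s : Term} (d : Derivation t s) (hd : d.IsNormalizing)
    (h : Bv t u) : ∃ d' : Derivation u s, d'.numBetaV + 1 = d.numBetaV := by
  induction d generalizing u with
  | nil t => exact ((isNormal_stepShuf_iff.1 hd).1 _ h).elim
  | betaV hb d ih =>
    obtain rfl | ⟨r, h₁, h₂⟩ := h.diamond (stepBetaV_iff.1 hb)
    · exact ⟨d, rfl⟩
    · obtain ⟨d', hd'⟩ := ih hd h₂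
      exact ⟨.betaV (stepBetaV_iff.2 h₁) d', congrArg (· + 1) hd'⟩
  | sigma hs d ih =>
    obtain ⟨r, h₁, h₂⟩ := h.sigma_commute (stepSigma_iff.1 hs)
    obtain ⟨d₁, hd₁⟩ := ih hd h₂
    obtain ⟨d₂, hd₂⟩ := exists_of_sigma_star h₁.to_reflTransGen d₁
    exact ⟨d₂, (congrArg (· + 1) hd₂).trans hd₁⟩

theorem numBetaV_eq {t u u' : Term} (d : Derivation t u) (d' : Derivation t u')
    (hd : d.IsNormalizing) (hd' : d'.IsNormalizing) : d.numBetaV = d'.numBetaV := by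
  induction d with
  | nil t =>
    cases d' with
    | nil => rfl
    | betaV h => exact (hd _ (.inl h)).elim
    | sigma h => exact (hd _ (.inr h)).elim
  | betaV h d ih =>
    obtain ⟨e, he⟩ := d'.exists_numBetaV_succ_eq hd' (stepBetaV_iff.1 h)
    exact (congrArg (· + 1) (ih e hd hd')).trans he
  | sigma h d ih =>
    obtain ⟨e, he⟩ := d'.exists_numBetaV_eq_of_sigma hd' (.single (stepSigma_iff.1 h))
    exact (ih e hd hd').trans he

theorem length_eq {t u : Term} (d : Derivation t u) : d.length = d.numBetaV + d.numSigma := by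
  induction d with
  | nil => rfl
  | betaV _ d ih => simp only [length, numBetaV, numSigma, ih]; omega
  | sigma _ d ih => simp only [length, numBetaV, numSigma, ih]; omega

/-- Under strong confluence, a step can be removed from any normalizing derivation. -/
theorem exists_length_succ_eq (hc : StronglyConfluent StepShuf) {t u s : Term}
    (d : Derivation t s) (hd : d.IsNormalizing) (h : StepShuf t u) :
    ∃ d' : Derivation u s, d'.length + 1 = d.length := by
  have cons : ∀ {a b s : Term}, StepShuf a b → ∀ e : Derivation b s,
      ∃ e' : Derivation a s, e'.length = e.length + 1 := fun h e =>
    h.elim (fun h => ⟨.betaV h e, rfl⟩) fun h => ⟨.sigma h e, rfl⟩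
  -- The closing step may have either label, so only lengths are tracked: the step `b → r` is
  -- removed from `e` and `c → r` is put in its place.
  have key : ∀ {a b s : Term}, StepShuf a b → ∀ e : Derivation b s,
      (∀ {c : Term}, StepShuf b c → ∃ e' : Derivation c s, e'.length + 1 = e.length) →
      ∀ {c : Term}, StepShuf a c → ∃ e' : Derivation c s, e'.length = e.length := by
    intro a b s hb e ih c hac
    by_cases hbc : b = c
    · subst hbc
      exact ⟨e, rfl⟩
    · obtain ⟨r, h₁, h₂⟩ := hc a b c hb hac hbc
      obtain ⟨e₁, he₁⟩ := ih h₁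
      obtain ⟨e₂, he₂⟩ := cons h₂ e₁
      exact ⟨e₂, he₂.trans he₁⟩
  induction d generalizing u with
  | nil t => exact (hd _ h).elim
  | betaV hb d ih =>
    obtain ⟨e, he⟩ := key (.inl hb) d (fun h => ih hd h) h
    exact ⟨e, congrArg (· + 1) he⟩
  | sigma hs d ih =>
    obtain ⟨e, he⟩ := key (.inr hs) d (fun h => ih hd h) h
    exact ⟨e, congrArg (· + 1) he⟩

end Derivation

/-! ### A term with normalizing derivations of different lengths -/

/-- The term `((λx.x) ((λz.y y) (y y))) y`. -/
def forkTerm : Term :=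
  app (app (lam (var 0)) (app (lam (app (var 1) (var 1))) (app (var 0) (var 0)))) (var 0)

/-- The term `(λz.(λx.x y) (y y)) (y y)`. -/
def forkNormal : Term :=
  app (lam (app (lam (app (var 0) (var 2))) (app (var 1) (var 1)))) (app (var 0) (var 0))

theorem isNormal_forkNormal : IsNormal StepShuf forkNormal := by
  rw [isNormal_stepShuf_iff]
  have hb : ∀ m n u, ¬ Bv (app (var m) (var n)) u := by
    intro m n u h
    cases h with
    | appRight _ h => cases h
    | appLeft h => cases h
  have hs : ∀ m n u, ¬ Sg (app (var m) (var n)) u := by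
    intro m n u h
    cases h with
    | appRight _ h => cases h
    | appLeft h => cases h
  have hb' : ∀ u, ¬ Bv (app (lam (app (var 0) (var 2))) (app (var 1) (var 1))) u := by
    intro u h
    cases h with
    | root _ hv => cases hv
    | appRight _ h => exact hb _ _ _ h
    | appLeft h => cases h
    | lamApp h => exact hb _ _ _ h
  have hs' : ∀ u, ¬ Sg (app (lam (app (var 0) (var 2))) (app (var 1) (var 1))) u := by
    intro u h
    cases h with
    | appRight _ h => exact hs _ _ _ h
    | appLeft h => cases h
    | lamApp h => exact hs _ _ _ h
  constructor
  · intro u h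
    cases h with
    | root _ hv => cases hv
    | appRight _ h => exact hb _ _ _ h
    | appLeft h => cases h
    | lamApp h => exact hb' _ h
  · intro u h
    cases h with
    | appRight _ h => exact hs _ _ _ h
    | appLeft h => cases h
    | lamApp h => exact hs' _ h

/-- The derivation that starts with the outermost redex. -/
def forkShort : Derivation forkTerm forkNormal :=
  .sigma (stepSigma_iff.2 (.left _ _ _)) <|
  .sigma (stepSigma_iff.2 (.right (.lam _) _ _)) <|
  .nil _

/-- The derivation that starts with the innermost redex. -/
def forkLong : Derivation forkTerm forkNormal :=
  .sigma (stepSigma_iff.2 (.appLeft (.right (.lam _) _ _) _)) <|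
  .sigma (stepSigma_iff.2 (.left _ _ _)) <|
  .sigma (stepSigma_iff.2 (.lamApp (.left _ _ _) _)) <|
  .nil _

/-- Removing the two steps of `forkShort` from `forkLong` would leave a derivation of length one
from a normal term. -/
theorem not_stronglyConfluent_stepShuf : ¬ StronglyConfluent StepShuf := by
  intro hc
  have h₁ : StepShuf forkTerm _ := .inr (stepSigma_iff.2 (.left _ _ _))
  have h₂ : StepShuf (app (lam (app (var 0) (var 1)))
      (app (lam (app (var 1) (var 1))) (app (var 0) (var 0)))) forkNormal :=
    .inr (stepSigma_iff.2 (.right (.lam _) _ _))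
  obtain ⟨d, hd⟩ := forkLong.exists_length_succ_eq hc isNormal_forkNormal h₁
  obtain ⟨e, he⟩ := d.exists_length_succ_eq hc isNormal_forkNormal h₂
  have hl : forkLong.length = 3 := rfl
  cases e with
  | nil => simp only [Derivation.length] at he; omega
  | betaV h => exact isNormal_forkNormal _ (.inl h)
  | sigma h => exact isNormal_forkNormal _ (.inr h)

end Shuffling

theorem mainTheorem5 :
    (∀ (t u u' : Shuffling.Term)
        (d : Shuffling.Derivation t u) (d' : Shuffling.Derivation t u'),
        d.IsNormalizing → d'.IsNormalizing →
          d.numBetaV = d'.numBetaV ∧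
          (d.length : ℤ) - (d'.length : ℤ) = (d.numSigma : ℤ) - (d'.numSigma : ℤ)) ∧
    ¬ Shuffling.StronglyConfluent Shuffling.StepShuf ∧
    (∃ (t u u' : Shuffling.Term)
        (d : Shuffling.Derivation t u) (d' : Shuffling.Derivation t u'),
        d.IsNormalizing ∧ d'.IsNormalizing ∧ d.length ≠ d'.length) := by
  refine ⟨fun t u u' d d' hd hd' => ?_, Shuffling.not_stronglyConfluent_stepShuf,
    Shuffling.forkTerm, Shuffling.forkNormal, Shuffling.forkNormal, Shuffling.forkShort,
    Shuffling.forkLong, Shuffling.isNormal_forkNormal, Shuffling.isNormal_forkNormal,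
    show 2 ≠ 3 by decide⟩
  have h := d.numBetaV_eq d' hd hd'
  refine ⟨h, ?_⟩
  rw [d.length_eq, d'.length_eq, h]
  push_cast
  ring
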